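/- Let $\mathbb{K}$ be a field, $\ell\ge 1$ an integer and $V=\mathbb{K}^\ell$. An arrangement $\mathcal{A}$ in $V$ is a finite set of hyperplanes, i.e. of linear subspaces of codimension one in $V$; its rank is $\operatorname{rank}(\mathcal{A}):=\operatorname{codim}\bigcap_{H\in\mathcal{A}}H$, the intersection over the empty set being $V$. For $H\in\mathcal{A}$ put $\mathcal{A}^H:=\{L\cap H\mid L\in\mathcal{A},\ H\not\subseteq L\}$. For subsets $\pi_1,\dots,\pi_n$ ($n \ge 1$) of $\mathcal{A}$ that are pairwise disjoint with union $\mathcal{A}$, put $\mathcal{A}_{k}:=\pi_1\sqcup\dots\sqcup\pi_k$ and $\mathcal{A}_0:=\varnothing$, and consider, for every $k\in\{1,\dots,n\}$, the conditions (MP1) $\operatorname{rank}(\pi_k)=|\pi_k|$; (MP2) there is no $H'\in\mathcal{A}_{k-1}$ with $\bigcap_{H\in\pi_k}H\subseteq H'$; (MP3) $|\mathcal{A}_{k-1}|-|(\mathcal{A}_{k-1}\cup\{H\})^H|=k-1$ for each $H\in\pi_k$. If $\mathcal{A}\neq\varnothing$, then $(\pi_1,\dots,\pi_n)$ is called an MAT-partition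 of $\mathcal{A}$ if all $\pi_k$ are nonempty and (MP1)–(MP3) hold for every $k\in\{1,\dots,n\}$. The arrangement $\mathcal{A}$ is called MAT-free if it is empty or admits an MAT-partition. Proposition 4.1 (no internal empty block). An arrangement $\mathcal{A}$ is MAT-free if and only if it is the disjoint union of possibly empty subsets $\pi_1,\dots,\pi_n$, for some $n\ge 1$, that satisfy (MP1)–(MP3) for every $k\in\{1,\dots,n\}$. Moreover, for every such decomposition, empty blocks occur only at the end and may be dropped: there is $p\in\{0,\dots,n\}$ such that $\pi_k\neq\varnothing$ if and only if $k\le p$, and if $\mathcal{A}\ne\varnothing$, then $(\pi_1,\dots,\pi_p)$ is an MAT-partition of $\mathcal{A}$. -/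

import Mathlib

namespace Arrangement

variable {K : Type*} [Field K] {ℓ : ℕ}

/-- A hyperplane of `K ^ ℓ`: a linear subspace of codimension one. -/
def IsHyperplane (H : Submodule K (Fin ℓ → K)) : Prop :=
  Module.finrank K ((Fin ℓ → K) ⧸ H) = 1

/-- An arrangement in `K ^ ℓ`: a finite set of (linear) hyperplanes. -/
def IsArrangement (A : Set (Submodule K (Fin ℓ → K))) : Prop :=
  A.Finite ∧ ∀ H ∈ A, IsHyperplane H

/-- The rank of an arrangement: the codimension of the intersection of its members
(the intersection over the empty set is the whole space). -/
noncomputable def rank (A : Set (Submodule K (Fin ℓ → K))) : ℕ :=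
  Module.finrank K ((Fin ℓ → K) ⧸ sInf A)

/-- The localization of `A` on the subspace `X`. -/
def localization (A : Set (Submodule K (Fin ℓ → K))) (X : Submodule K (Fin ℓ → K)) :
    Set (Submodule K (Fin ℓ → K)) :=
  {L ∈ A | X ≤ L}

/-- The restriction of `A` to the subspace `X`; its members `L ∩ X` are recorded as
subspaces of the ambient space. -/
def restriction (A : Set (Submodule K (Fin ℓ → K))) (X : Submodule K (Fin ℓ → K)) :
    Set (Submodule K (Fin ℓ → K)) :=
  (fun L => L ⊓ X) '' (A \ localization A X)

/-- The union of the blocks strictly before the block with index `k`. The blocks are indexed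
from `0`, so the index `k : Fin n` stands for the `(k + 1)`-st block. -/
def before {n : ℕ} (π : Fin n → Set (Submodule K (Fin ℓ → K))) (k : Fin n) :
    Set (Submodule K (Fin ℓ → K)) :=
  ⋃ j : Fin n, ⋃ _ : j < k, π j

/-- (MP1): each block has rank equal to its cardinality. -/
def MP1 {n : ℕ} (π : Fin n → Set (Submodule K (Fin ℓ → K))) (k : Fin n) : Prop :=
  rank (π k) = (π k).ncard

/-- (MP2): no hyperplane of an earlier block contains the intersection of the block. -/
def MP2 {n : ℕ} (π : Fin n → Set (Submodule K (Fin ℓ → K))) (k : Fin n) : Prop :=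
  ¬ ∃ H' ∈ before π k, sInf (π k) ≤ H'

/-- (MP3): for each `H` in the block, the number of earlier hyperplanes minus the size of the
restriction to `H` is the number of earlier blocks. -/
def MP3 {n : ℕ} (π : Fin n → Set (Submodule K (Fin ℓ → K))) (k : Fin n) : Prop :=
  ∀ H ∈ π k,
    ((before π k).ncard : ℤ) - ((restriction (before π k ∪ {H}) H).ncard : ℤ) = ((k : ℕ) : ℤ)

/-- `A` is the disjoint union of the possibly empty blocks `π`, and (MP1), (MP2), (MP3) hold
for every block. -/
structure IsMATDecomposition (A : Set (Submodule K (Fin ℓ → K))) {n : ℕ}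
    (π : Fin n → Set (Submodule K (Fin ℓ → K))) : Prop where
  iUnion_eq : ⋃ k, π k = A
  disjoint : ∀ i j, i ≠ j → Disjoint (π i) (π j)
  mp1 : ∀ k, MP1 π k
  mp2 : ∀ k, MP2 π k
  mp3 : ∀ k, MP3 π k

/-- An MAT-partition of the nonempty arrangement `A`: all blocks are nonempty. -/
structure IsMATPartition (A : Set (Submodule K (Fin ℓ → K))) {n : ℕ}
    (π : Fin n → Set (Submodule K (Fin ℓ → K))) : Prop
    extends IsMATDecomposition A π where
  nonempty : A.Nonempty
  block_nonempty : ∀ k, (π k).Nonempty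

/-- An arrangement is MAT-free if it is empty or admits an MAT-partition. -/
def IsMATFree (A : Set (Submodule K (Fin ℓ → K))) : Prop :=
  A = ∅ ∨ ∃ (n : ℕ) (π : Fin n → Set (Submodule K (Fin ℓ → K))), IsMATPartition A π

end Arrangement

namespace Arrangement

variable {K : Type*} [Field K] {ℓ : ℕ}

open MvPolynomial

/-! ### Linear forms, substitutions and restriction to a hyperplane -/

/-- The pairing of a vector `θ` with a vector of scalars: the value of the derivation with
coefficients `θ` on the linear form with coefficients `a`. -/
noncomputable def contract (θ : Fin ℓ → MvPolynomial (Fin ℓ) K) :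
    (Fin ℓ → K) →ₗ[K] MvPolynomial (Fin ℓ) K :=
  Fintype.linearCombination K θ

/-- The linear form with given coefficients, as a polynomial. -/
noncomputable def linForm : (Fin ℓ → K) →ₗ[K] MvPolynomial (Fin ℓ) K :=
  contract X

/-- The substitution induced by a linear endomorphism of the space of linear forms. -/
noncomputable def linSubst (U : (Fin ℓ → K) →ₗ[K] (Fin ℓ → K)) :
    MvPolynomial (Fin ℓ) K →ₐ[K] MvPolynomial (Fin ℓ) K :=
  aeval fun i => linForm (U (Pi.single i 1))

theorem contract_apply (θ : Fin ℓ → MvPolynomial (Fin ℓ) K) (a : Fin ℓ → K) :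
    contract θ a = ∑ i, C (a i) * θ i := by
  simp [contract, Fintype.linearCombination_apply, smul_eq_C_mul]

theorem linForm_single (i : Fin ℓ) : linForm (Pi.single i (1 : K)) = X i := by
  simp [linForm, contract]

theorem linSubst_linForm (U : (Fin ℓ → K) →ₗ[K] (Fin ℓ → K)) (a : Fin ℓ → K) :
    linSubst U (linForm a) = linForm (U a) := by
  have : (linSubst U).toLinearMap ∘ₗ linForm = linForm ∘ₗ U := by
    refine LinearMap.pi_ext' fun i => LinearMap.ext_ring ?_
    simp [linForm_single, linSubst]
  exact LinearMap.congr_fun this a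

theorem linSubst_comp (U U' : (Fin ℓ → K) →ₗ[K] (Fin ℓ → K)) (f : MvPolynomial (Fin ℓ) K) :
    linSubst U (linSubst U' f) = linSubst (U ∘ₗ U') f := by
  have : (linSubst U).comp (linSubst U') = linSubst (U ∘ₗ U') := by
    refine MvPolynomial.algHom_ext fun i => ?_
    rw [← linForm_single]
    simp [linSubst_linForm]
  exact AlgHom.congr_fun this f

theorem isHomogeneous_linForm (a : Fin ℓ → K) : (linForm a).IsHomogeneous 1 := by
  rw [linForm, contract_apply]
  refine IsHomogeneous.sum _ _ _ fun i _ => ?_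
  simpa using (isHomogeneous_C (Fin ℓ) (a i)).mul (isHomogeneous_X K i)

theorem linForm_injective : Function.Injective (linForm : (Fin ℓ → K) → _) := by
  intro a b h
  ext i
  have := congrArg (coeff (Finsupp.single i 1)) h
  simpa [linForm, contract_apply, coeff_sum, coeff_C_mul, coeff_X, Finsupp.single_left_inj] using this

theorem linForm_ne_zero {a : Fin ℓ → K} (ha : a ≠ 0) : linForm a ≠ 0 := by
  rw [← map_zero linForm]
  exact linForm_injective.ne ha

theorem totalDegree_linSubst_le (U : (Fin ℓ → K) →ₗ[K] (Fin ℓ → K))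
    (f : MvPolynomial (Fin ℓ) K) : (linSubst U f).totalDegree ≤ f.totalDegree := by
  rw [linSubst, aeval_def, eval₂_eq]
  refine totalDegree_finsetSum_le fun m hm => ?_
  refine (totalDegree_mul _ _).trans ?_
  rw [algebraMap_eq, totalDegree_C, zero_add]
  refine (totalDegree_finsetProd _ _).trans ?_
  refine le_trans ?_ (le_totalDegree hm)
  refine Finset.sum_le_sum fun i _ => (totalDegree_pow _ _).trans ?_
  exact mul_le_of_le_one_right' (isHomogeneous_linForm _).totalDegree_le

theorem totalDegree_contract_le {θ : Fin ℓ → MvPolynomial (Fin ℓ) K} {d : ℕ}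
    (hθ : ∀ i, (θ i).totalDegree ≤ d) (a : Fin ℓ → K) : (contract θ a).totalDegree ≤ d := by
  rw [contract_apply]
  refine totalDegree_finsetSum_le fun i _ => (totalDegree_mul _ _).trans ?_
  simpa using hθ i

/-- The projection of the space of linear forms along `a` determined by the vector `v`. For
`v ⬝ᵥ a = 1` the corresponding substitution is the restriction to the hyperplane `a = 0`. -/
noncomputable def projAlong (v a : Fin ℓ → K) : (Fin ℓ → K) →ₗ[K] (Fin ℓ → K) :=
  LinearMap.id - (dotProductEquiv K (Fin ℓ) v).smulRight a

theorem projAlong_apply (v a b : Fin ℓ → K) : projAlong v a b = b - (v ⬝ᵥ b) • a := by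
  simp [projAlong]

theorem projAlong_self {v a : Fin ℓ → K} (hv : v ⬝ᵥ a = 1) : projAlong v a a = 0 := by
  simp [projAlong_apply, hv]

theorem exists_dotProduct_eq_one {a : Fin ℓ → K} (ha : a ≠ 0) : ∃ v : Fin ℓ → K, v ⬝ᵥ a = 1 := by
  obtain ⟨i, hi⟩ := Function.ne_iff.mp ha
  exact ⟨Pi.single i (a i)⁻¹, by simpa using inv_mul_cancel₀ hi⟩

/-- Modulo `linForm a` the substitution fixes every variable, hence every polynomial. -/
theorem linForm_dvd_sub_linSubst_projAlong (v a : Fin ℓ → K) (f : MvPolynomial (Fin ℓ) K) :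
    linForm a ∣ f - linSubst (projAlong v a) f := by
  have : (Ideal.Quotient.mkₐ K (Ideal.span {linForm a})).comp (linSubst (projAlong v a)) =
      Ideal.Quotient.mkₐ K (Ideal.span {linForm a}) := by
    refine MvPolynomial.algHom_ext fun i => ?_
    have h0 : Ideal.Quotient.mkₐ K (Ideal.span {linForm a}) (linForm a) = 0 :=
      Ideal.Quotient.eq_zero_iff_mem.mpr (Ideal.mem_span_singleton_self _)
    rw [AlgHom.comp_apply, ← linForm_single, linSubst_linForm, projAlong_apply, map_sub, map_smul,
      map_sub, map_smul, h0, smul_zero, sub_zero]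
  rw [← Ideal.mem_span_singleton]
  exact Ideal.Quotient.eq.mp (AlgHom.congr_fun this f).symm

theorem linForm_dvd_iff {v a : Fin ℓ → K} (hv : v ⬝ᵥ a = 1) (f : MvPolynomial (Fin ℓ) K) :
    linForm a ∣ f ↔ linSubst (projAlong v a) f = 0 := by
  constructor
  · rintro ⟨g, rfl⟩
    simp [linSubst_linForm, projAlong_self hv]
  · intro h
    simpa [h] using linForm_dvd_sub_linSubst_projAlong v a f

/-- The multiples of `linForm a` are the kernel of a ring homomorphism into a domain. -/
theorem prime_linForm {a : Fin ℓ → K} (ha : a ≠ 0) : Prime (linForm a) := by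
  obtain ⟨v, hv⟩ := exists_dotProduct_eq_one ha
  refine ⟨linForm_ne_zero ha, fun h => ?_, fun f g h => ?_⟩
  · have := (linForm_dvd_iff hv 1).mp h.dvd
    simp at this
  · rw [linForm_dvd_iff hv] at h ⊢
    rw [linForm_dvd_iff hv]
    simpa using h

theorem isRelPrime_linForm {a b : Fin ℓ → K} (ha : a ≠ 0) (hab : ∀ c : K, b ≠ c • a) :
    IsRelPrime (linForm a) (linForm b) := by
  obtain ⟨v, hv⟩ := exists_dotProduct_eq_one ha
  rw [(prime_linForm ha).irreducible.isRelPrime_iff_not_dvd, linForm_dvd_iff hv, linSubst_linForm]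
  refine fun h => hab (v ⬝ᵥ b) ?_
  rw [← map_zero linForm] at h
  have := linForm_injective h
  rwa [projAlong_apply, sub_eq_zero] at this

/-! ### Terao's polynomial -/

/-- The restriction of `θ(a)` to the hyperplane `a = 0` is divisible by a power of each linear
form on that hyperplane that is the restriction of several linear forms along which `θ` is
logarithmic. -/
theorem pow_dvd_linSubst_contract {ι : Type*} {F : Finset ι} {n : ι → Fin ℓ → K}
    {v a : Fin ℓ → K} (hv : v ⬝ᵥ a = 1)
    (hn : ∀ i ∈ F, projAlong v a (n i) ≠ 0)
    (hne : ∀ i ∈ F, ∀ j ∈ F, i ≠ j → ∀ c : K, n j ≠ c • n i) {i₀ : ι} (hi₀ : i₀ ∈ F)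
    (hF : ∀ i ∈ F, ∃ c : K, projAlong v a (n i) = c • projAlong v a (n i₀))
    {θ : Fin ℓ → MvPolynomial (Fin ℓ) K} (hθ : ∀ i ∈ F, linForm (n i) ∣ contract θ (n i)) :
    linForm (projAlong v a (n i₀)) ^ (F.card - 1) ∣ linSubst (projAlong v a) (contract θ a) := by
  have hn0 : ∀ i ∈ F, n i ≠ 0 := fun i hi h => hn i hi (by rw [h, map_zero])
  -- Since `n i = s • n i₀ + t • a`, replacing `n i₀` by `n i` only multiplies this 2×2 determinant
  -- by the unit `s`, and in that form divisibility by `linForm (n i)` is visible.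
  have hdvd : ∏ i ∈ F, linForm (n i) ∣
      linForm a * contract θ (n i₀) - linForm (n i₀) * contract θ a := by
    refine Finset.prod_dvd_of_isRelPrime (fun i hi j hj hij => ?_) fun i hi => ?_
    · exact isRelPrime_linForm (hn0 i hi) (hne i hi j hj hij)
    · obtain ⟨s, hs⟩ := hF i hi
      have hs0 : s ≠ 0 := by
        rintro rfl
        exact hn i hi (by simpa using hs)
      have hni : n i = s • n i₀ + (v ⬝ᵥ n i - s * (v ⬝ᵥ n i₀)) • a := by
        rw [projAlong_apply, projAlong_apply, sub_eq_iff_eq_add] at hs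
        conv_lhs => rw [hs]
        module
      set t := v ⬝ᵥ n i - s * (v ⬝ᵥ n i₀)
      have : C s * (linForm a * contract θ (n i₀) - linForm (n i₀) * contract θ a) =
          linForm a * contract θ (n i) - linForm (n i) * contract θ a := by
        rw [hni]
        simp only [map_add, map_smul, smul_eq_C_mul]
        ring
      have hu : IsUnit (C s : MvPolynomial (Fin ℓ) K) := (isUnit_iff_ne_zero.mpr hs0).map C
      rw [← hu.dvd_mul_left, this]
      exact dvd_sub ((hθ i hi).mul_left _) (dvd_mul_right _ _)
  have h1 : ∏ i ∈ F, linSubst (projAlong v a) (linForm (n i)) ∣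
      linForm (projAlong v a (n i₀)) * linSubst (projAlong v a) (contract θ a) := by
    have := map_dvd (linSubst (projAlong v a)) hdvd
    rw [map_prod, map_sub, map_mul, map_mul, linSubst_linForm, linSubst_linForm,
      projAlong_self hv, map_zero, zero_mul, zero_sub, dvd_neg] at this
    exact this
  have h2 : linForm (projAlong v a (n i₀)) ^ F.card ∣
      ∏ i ∈ F, linSubst (projAlong v a) (linForm (n i)) := by
    rw [← Finset.prod_const]
    refine Finset.prod_dvd_prod_of_dvd _ _ fun i hi => ?_
    obtain ⟨s, hs⟩ := hF i hi
    have hs0 : s ≠ 0 := by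
      rintro rfl
      exact hn i hi (by simpa using hs)
    have hu : IsUnit (C s : MvPolynomial (Fin ℓ) K) := (isUnit_iff_ne_zero.mpr hs0).map C
    rw [linSubst_linForm, hs, map_smul, smul_eq_C_mul, hu.dvd_mul_left]
  have h3 := h2.trans h1
  have hc : F.card = (F.card - 1) + 1 := (Nat.sub_add_cancel (Finset.card_pos.mpr ⟨_, hi₀⟩)).symm
  rw [hc, pow_succ'] at h3
  exact (mul_dvd_mul_iff_left (linForm_ne_zero (hn _ hi₀))).mp h3

/-- Terao's polynomial: the restriction of `θ(a)` to the hyperplane `a = 0` is a multiple of a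
fixed polynomial whose degree is the drop in cardinality under restriction. -/
theorem exists_dvd_linSubst_contract {ι γ : Type*} [Nonempty ι] [DecidableEq γ] {B : Finset ι}
    {n : ι → Fin ℓ → K} {g : ι → γ} {v a : Fin ℓ → K} (hv : v ⬝ᵥ a = 1)
    (hn : ∀ i ∈ B, projAlong v a (n i) ≠ 0)
    (hne : ∀ i ∈ B, ∀ j ∈ B, i ≠ j → ∀ c : K, n j ≠ c • n i)
    (hg : ∀ i ∈ B, ∀ j ∈ B, g i = g j ↔ ∃ c : K, projAlong v a (n i) = c • projAlong v a (n j)) :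
    ∃ b : MvPolynomial (Fin ℓ) K, b ≠ 0 ∧ b.totalDegree + (B.image g).card = B.card ∧
      ∀ θ : Fin ℓ → MvPolynomial (Fin ℓ) K, (∀ i ∈ B, linForm (n i) ∣ contract θ (n i)) →
        b ∣ linSubst (projAlong v a) (contract θ a) := by
  classical
  have hrep : ∀ x ∈ B.image g, ∃ i, i ∈ B ∧ g i = x := fun x hx => Finset.mem_image.mp hx
  choose! r hr using hrep
  -- One factor per class of forms with proportional restrictions; the exponents sum to `|B|` minus
  -- the number of classes.
  set q : γ → MvPolynomial (Fin ℓ) K := fun x =>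
    linForm (projAlong v a (n (r x))) ^ ((B.filter (g · = x)).card - 1)
  have hq0 : ∏ x ∈ B.image g, q x ≠ 0 :=
    Finset.prod_ne_zero_iff.mpr fun x hx => pow_ne_zero _ (linForm_ne_zero (hn _ (hr x hx).1))
  refine ⟨∏ x ∈ B.image g, q x, hq0, ?_, fun θ hθ => ?_⟩
  · have hhom : (∏ x ∈ B.image g, q x).IsHomogeneous
        (∑ x ∈ B.image g, ((B.filter (g · = x)).card - 1)) := by
      refine IsHomogeneous.prod _ _ _ fun x _ => ?_
      simpa using (isHomogeneous_linForm _).pow _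
    rw [hhom.totalDegree hq0, Finset.card_eq_sum_card_image g B, Finset.card_eq_sum_ones,
      ← Finset.sum_add_distrib]
    refine Finset.sum_congr rfl fun x hx => Nat.sub_add_cancel (Finset.card_pos.mpr ?_)
    exact ⟨r x, Finset.mem_filter.mpr (hr x hx)⟩
  · refine Finset.prod_dvd_of_isRelPrime (fun x hx y hy hxy => ?_) fun x hx => ?_
    · refine IsRelPrime.pow (isRelPrime_linForm (hn _ (hr x hx).1) fun c hc => hxy ?_)
      have := (hg _ (hr y hy).1 _ (hr x hx).1).mpr ⟨c, hc⟩
      rw [← (hr x hx).2, ← (hr y hy).2, this]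
    · have hsub : ∀ i ∈ B.filter (g · = x), i ∈ B ∧ g i = x := fun i hi => Finset.mem_filter.mp hi
      refine pow_dvd_linSubst_contract hv (fun i hi => hn i (hsub i hi).1)
        (fun i hi j hj => hne i (hsub i hi).1 j (hsub j hj).1)
        (Finset.mem_filter.mpr (hr x hx)) (fun i hi => ?_) fun i hi => hθ i (hsub i hi).1
      rw [← hg i (hsub i hi).1 _ (hr x hx).1, (hsub i hi).2, (hr x hx).2]

theorem exists_eq_C_mul_of_dvd {σ : Type*} {b f : MvPolynomial σ K} (hb : b ≠ 0) (h : b ∣ f)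
    (hdeg : f.totalDegree ≤ b.totalDegree) : ∃ c : K, f = C c * b := by
  obtain ⟨g, rfl⟩ := h
  by_cases hg : g = 0
  · exact ⟨0, by simp [hg]⟩
  · rw [totalDegree_mul_of_isDomain hb hg] at hdeg
    have : g.totalDegree = 0 := by omega
    rw [totalDegree_eq_zero_iff_eq_C] at this
    exact ⟨coeff 0 g, by rw [← this, mul_comm]⟩

/-! ### Hyperplanes and their normals -/

theorem IsHyperplane.exists_normal {H : Submodule K (Fin ℓ → K)} (hH : IsHyperplane H) :
    ∃ a : Fin ℓ → K, a ≠ 0 ∧ ∀ x, x ∈ H ↔ a ⬝ᵥ x = 0 := by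
  have e : ((Fin ℓ → K) ⧸ H) ≃ₗ[K] K :=
    LinearEquiv.ofFinrankEq _ _ (by rw [hH, Module.finrank_self])
  set φ : Module.Dual K (Fin ℓ → K) := e.toLinearMap ∘ₗ H.mkQ with hφ
  have hmem : ∀ x, x ∈ H ↔ (dotProductEquiv K (Fin ℓ)).symm φ ⬝ᵥ x = 0 := fun x => by
    have : (dotProductEquiv K (Fin ℓ)) ((dotProductEquiv K (Fin ℓ)).symm φ) x = φ x := by
      rw [LinearEquiv.apply_symm_apply]
    rw [dotProductEquiv_apply_apply] at this
    rw [this]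
    simp [hφ]
  refine ⟨_, fun h0 => ?_, hmem⟩
  have htop : H = ⊤ := by
    ext x
    simp [hmem, h0]
  have : Module.finrank K ((Fin ℓ → K) ⧸ H) = 0 := by
    subst htop
    exact Module.finrank_zero_of_subsingleton
  rw [IsHyperplane, this] at hH
  exact zero_ne_one hH

open Classical in
/-- A normal vector of a hyperplane. -/
noncomputable def normal (H : Submodule K (Fin ℓ → K)) : Fin ℓ → K :=
  if hH : IsHyperplane H then hH.exists_normal.choose else 0

theorem IsHyperplane.normal_ne_zero {H : Submodule K (Fin ℓ → K)} (hH : IsHyperplane H) :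
    normal H ≠ 0 := by
  rw [normal, dif_pos hH]
  exact hH.exists_normal.choose_spec.1

theorem IsHyperplane.mem_iff {H : Submodule K (Fin ℓ → K)} (hH : IsHyperplane H)
    (x : Fin ℓ → K) : x ∈ H ↔ normal H ⬝ᵥ x = 0 := by
  rw [normal, dif_pos hH]
  exact hH.exists_normal.choose_spec.2 x

theorem IsHyperplane.eq_of_normal_eq_smul {H L : Submodule K (Fin ℓ → K)} (hH : IsHyperplane H)
    (hL : IsHyperplane L) {c : K} (h : normal L = c • normal H) : L = H := by
  have hc : c ≠ 0 := by
    rintro rfl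
    exact hL.normal_ne_zero (by simpa using h)
  ext x
  simp [hL.mem_iff, hH.mem_iff, h, hc]

theorem IsHyperplane.projAlong_normal_ne_zero {H L : Submodule K (Fin ℓ → K)}
    (hH : IsHyperplane H) (hL : IsHyperplane L) (hne : L ≠ H) (v : Fin ℓ → K) :
    projAlong v (normal H) (normal L) ≠ 0 := fun h => by
  rw [projAlong_apply, sub_eq_zero] at h
  exact hne (hH.eq_of_normal_eq_smul hL h)

theorem IsHyperplane.eq_of_le {H L : Submodule K (Fin ℓ → K)} (hH : IsHyperplane H)
    (hL : IsHyperplane L) (h : H ≤ L) : L = H := by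
  have hf := H.finrank_quotient_add_finrank
  have hf' := L.finrank_quotient_add_finrank
  rw [IsHyperplane] at hH hL
  exact (Submodule.eq_of_le_of_finrank_eq h (by omega)).symm

theorem inf_eq_inf_iff {H L L' : Submodule K (Fin ℓ → K)} (hH : IsHyperplane H)
    (hL : IsHyperplane L) (hL' : IsHyperplane L') (hne : L ≠ H) {v : Fin ℓ → K}
    (hv : v ⬝ᵥ normal H = 1) :
    L ⊓ H = L' ⊓ H ↔
      ∃ c : K, projAlong v (normal H) (normal L) = c • projAlong v (normal H) (normal L') := by
  constructor
  · intro h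
    -- A form vanishing on the common kernel of two forms lies in their span.
    have hmem : dotProductEquiv K (Fin ℓ) (normal L) ∈ Submodule.span K
        (Set.range ![dotProductEquiv K (Fin ℓ) (normal L'), dotProductEquiv K (Fin ℓ) (normal H)]) := by
      refine mem_span_of_iInf_ker_le_ker fun x hx => ?_
      have h0 := (Submodule.mem_iInf _).mp hx 0
      have h1 := (Submodule.mem_iInf _).mp hx 1
      simp only [Matrix.cons_val_zero, Matrix.cons_val_one, LinearMap.mem_ker,
        dotProductEquiv_apply_apply] at h0 h1 ⊢
      have : x ∈ L' ⊓ H := ⟨(hL'.mem_iff x).mpr h0, (hH.mem_iff x).mpr h1⟩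
      rw [← h] at this
      exact (hL.mem_iff x).mp this.1
    rw [Matrix.range_cons, Matrix.range_cons, Matrix.range_empty, Set.union_empty,
      Set.singleton_union, Submodule.mem_span_pair] at hmem
    obtain ⟨c, t, hct⟩ := hmem
    rw [← map_smul, ← map_smul, ← map_add, EmbeddingLike.apply_eq_iff_eq] at hct
    refine ⟨c, ?_⟩
    rw [← hct, map_add, map_smul, map_smul, projAlong_self hv, smul_zero, add_zero]
  · rintro ⟨c, hc⟩
    have hc0 : c ≠ 0 := by
      rintro rfl
      exact hH.projAlong_normal_ne_zero hL hne v (by simpa using hc)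
    ext x
    simp only [Submodule.mem_inf]
    refine and_congr_left fun hx => ?_
    rw [hH.mem_iff] at hx
    have := congrArg (· ⬝ᵥ x) hc
    simp only [projAlong_apply, sub_dotProduct, smul_dotProduct, hx, smul_zero, sub_zero] at this
    rw [hL.mem_iff, hL'.mem_iff, this]
    simp [hc0]

theorem restriction_union_singleton {B : Set (Submodule K (Fin ℓ → K))}
    {H : Submodule K (Fin ℓ → K)} (hB : ∀ L ∈ B, IsHyperplane L) (hH : IsHyperplane H)
    (hHB : H ∉ B) : restriction (B ∪ {H}) H = (· ⊓ H) '' B := by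
  have : (B ∪ {H}) \ localization (B ∪ {H}) H = B := by
    ext L
    constructor
    · rintro ⟨hL | rfl, hn⟩
      · exact hL
      · exact absurd ⟨Or.inr rfl, le_rfl⟩ hn
    · refine fun hL => ⟨Or.inl hL, fun h => hHB ?_⟩
      rwa [← hH.eq_of_le (hB L hL) h.2]
  rw [restriction, this]

/-- The polynomial of `exists_dvd_linSubst_contract` for an arrangement and a further hyperplane. -/
theorem exists_dvd_linSubst_contract_normal {B : Set (Submodule K (Fin ℓ → K))}
    {H : Submodule K (Fin ℓ → K)} (hB : IsArrangement B) (hH : IsHyperplane H) (hHB : H ∉ B)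
    {v : Fin ℓ → K} (hv : v ⬝ᵥ normal H = 1) :
    ∃ b : MvPolynomial (Fin ℓ) K, b ≠ 0 ∧
      b.totalDegree + (restriction (B ∪ {H}) H).ncard = B.ncard ∧
      ∀ θ : Fin ℓ → MvPolynomial (Fin ℓ) K,
        (∀ L ∈ B, linForm (normal L) ∣ contract θ (normal L)) →
        b ∣ linSubst (projAlong v (normal H)) (contract θ (normal H)) := by
  classical
  obtain ⟨s, rfl⟩ := hB.1.exists_finset_coe
  have hs : ∀ L ∈ s, IsHyperplane L ∧ L ≠ H := fun L hL =>
    ⟨hB.2 L hL, fun h => hHB (h ▸ hL)⟩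
  rw [restriction_union_singleton hB.2 hH hHB, ← Finset.coe_image, Set.ncard_coe_finset,
    Set.ncard_coe_finset]
  exact exists_dvd_linSubst_contract hv
    (fun L hL => hH.projAlong_normal_ne_zero (hs L hL).1 (hs L hL).2 v)
    (fun L hL L' hL' hne c hc => hne ((hs L hL).1.eq_of_normal_eq_smul (hs L' hL').1 hc).symm)
    fun L hL L' hL' => inf_eq_inf_iff hH (hs L hL).1 (hs L' hL').1 (hs L hL).2 hv

/-- The matrix of normals has kernel `sInf P`, so its row rank is `rank P`. -/
theorem linearIndependent_normal {P : Set (Submodule K (Fin ℓ → K))} (hP : IsArrangement P)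
    (hr : rank P = P.ncard) :
    LinearIndependent K fun H : P => normal (H : Submodule K (Fin ℓ → K)) := by
  have := hP.1.fintype
  set A : Matrix P (Fin ℓ) K := Matrix.of fun H => normal (H : Submodule K (Fin ℓ → K)) with hA
  have hker : LinearMap.ker A.mulVecLin = sInf P := by
    ext x
    rw [LinearMap.mem_ker, Matrix.mulVecLin_apply, Submodule.mem_sInf, funext_iff]
    constructor
    · exact fun h H hH => ((hP.2 H hH).mem_iff x).mpr (h ⟨H, hH⟩)
    · exact fun h H => ((hP.2 H H.2).mem_iff x).mp (h H H.2)
  rw [linearIndependent_iff_card_eq_finrank_span, Set.finrank]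
  have h1 : A.rank = rank P := by
    rw [Matrix.rank, rank, ← hker]
    exact (LinearMap.quotKerEquivRange _).finrank_eq.symm
  rw [Matrix.rank_eq_finrank_span_row, hr, ← Nat.card_coe_set_eq, Nat.card_eq_fintype_card] at h1
  exact h1.symm

theorem sInf_le_of_normal_mem_span {P : Set (Submodule K (Fin ℓ → K))}
    {L : Submodule K (Fin ℓ → K)} (hP : ∀ H ∈ P, IsHyperplane H) (hL : IsHyperplane L)
    (h : normal L ∈ Submodule.span K (normal '' P)) : sInf P ≤ L := by
  intro x hx
  rw [Submodule.mem_sInf] at hx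
  rw [hL.mem_iff]
  generalize normal L = a at h
  induction h using Submodule.span_induction with
  | mem a ha =>
    obtain ⟨H, hH, rfl⟩ := ha
    exact ((hP H hH).mem_iff x).mp (hx H hH)
  | zero => simp
  | add a b _ _ iha ihb => rw [add_dotProduct, iha, ihb, add_zero]
  | smul c a _ ih => rw [smul_dotProduct, ih, smul_zero]

/-! ### Adapted matrices and the multiple addition step -/

/-- A square matrix of polynomials of degree at most `d` whose rows are logarithmic derivations
of `B`, and whose determinant vanishes only where a member of `B` does. -/
structure IsAdapted (B : Set (Submodule K (Fin ℓ → K))) (d : ℕ)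
    (M : Matrix (Fin ℓ) (Fin ℓ) (MvPolynomial (Fin ℓ) K)) : Prop where
  totalDegree_le : ∀ i j, (M i j).totalDegree ≤ d
  dvd : ∀ L ∈ B, ∀ i, linForm (normal L) ∣ contract (M i) (normal L)
  det_ne_zero : ∀ U : (Fin ℓ → K) →ₗ[K] (Fin ℓ → K), (∀ L ∈ B, U (normal L) ≠ 0) →
    linSubst U M.det ≠ 0

theorem isAdapted_empty :
    IsAdapted (∅ : Set (Submodule K (Fin ℓ → K))) 0 1 where
  totalDegree_le i j := by
    rw [Matrix.one_apply]
    split_ifs <;> simp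
  dvd L hL := absurd hL (Set.notMem_empty L)
  det_ne_zero U _ := by simp

theorem mulVec_eq_contract {m : Type*} (M : Matrix m (Fin ℓ) (MvPolynomial (Fin ℓ) K))
    (a : Fin ℓ → K) (i : m) : (M.mulVec fun j => C (a j)) i = contract (M i) a := by
  rw [contract_apply, Matrix.mulVec, dotProduct]
  exact Finset.sum_congr rfl fun j _ => mul_comm _ _

theorem linSubst_contract (U : (Fin ℓ → K) →ₗ[K] (Fin ℓ → K))
    (θ : Fin ℓ → MvPolynomial (Fin ℓ) K) (a : Fin ℓ → K) :
    linSubst U (contract θ a) = contract (fun j => linSubst U (θ j)) a := by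
  simp [contract_apply, linSubst]

/-- If the determinant survives a substitution, then a nonzero linear form is not killed by all
rows. -/
theorem exists_linSubst_contract_ne_zero {M : Matrix (Fin ℓ) (Fin ℓ) (MvPolynomial (Fin ℓ) K)}
    {U : (Fin ℓ → K) →ₗ[K] (Fin ℓ → K)} (hM : linSubst U M.det ≠ 0) {a : Fin ℓ → K}
    (ha : a ≠ 0) : ∃ i, linSubst U (contract (M i) a) ≠ 0 := by
  by_contra! h
  rw [AlgHom.map_det] at hM
  refine ha (funext fun j => ?_)
  have := Matrix.eq_zero_of_mulVec_eq_zero hM (v := fun j => C (a j)) <| funext fun i => by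
    rw [mulVec_eq_contract]
    exact (linSubst_contract U (M i) a).symm.trans (h i)
  simpa using congrFun this j

/-- This bound on the drop is what (MP3) contradicts for a nonempty block after an empty one. -/
theorem IsAdapted.ncard_le {B : Set (Submodule K (Fin ℓ → K))} {d : ℕ}
    {M : Matrix (Fin ℓ) (Fin ℓ) (MvPolynomial (Fin ℓ) K)} (hM : IsAdapted B d M)
    (hB : IsArrangement B) {H : Submodule K (Fin ℓ → K)} (hH : IsHyperplane H) (hHB : H ∉ B) :
    B.ncard ≤ d + (restriction (B ∪ {H}) H).ncard := by
  obtain ⟨v, hv⟩ := exists_dotProduct_eq_one hH.normal_ne_zero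
  obtain ⟨b, hb, hdeg, hdvd⟩ := exists_dvd_linSubst_contract_normal hB hH hHB hv
  obtain ⟨i, hi⟩ := exists_linSubst_contract_ne_zero
    (hM.det_ne_zero (projAlong v (normal H)) fun L hL =>
      hH.projAlong_normal_ne_zero (hB.2 L hL) (fun h => hHB (h ▸ hL)) v) hH.normal_ne_zero
  have h1 := totalDegree_le_of_dvd_of_isDomain (hdvd (M i) fun L hL => hM.dvd L hL i) hi
  have h2 := (totalDegree_linSubst_le (projAlong v (normal H)) (contract (M i) (normal H))).trans
    (totalDegree_contract_le (hM.totalDegree_le i) _)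
  omega

theorem eq_zero_of_sum_mul_C_eq_zero {ι σ : Type*} [Fintype ι] {n : ι → Fin ℓ → K}
    (hn : LinearIndependent K n) {g : ι → MvPolynomial σ K}
    (hg : ∀ j, ∑ k, g k * C (n k j) = 0) (k : ι) : g k = 0 := by
  ext m
  refine Fintype.linearIndependent_iff.mp hn (fun k => coeff m (g k)) (funext fun j => ?_) k
  have h := congrArg (coeff m) (hg j)
  simp_rw [mul_comm (g _), coeff_sum, coeff_C_mul] at h
  simpa [mul_comm] using h

/-- The constants expressing the values of the rows on independent linear forms as multiples of
fixed polynomials form an injective matrix. -/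
theorem mulVec_injective_of_linSubst_contract {ι : Type*} [Fintype ι] {n : ι → Fin ℓ → K}
    (hn : LinearIndependent K n) {M : Matrix (Fin ℓ) (Fin ℓ) (MvPolynomial (Fin ℓ) K)}
    {U : (Fin ℓ → K) →ₗ[K] (Fin ℓ → K)} (hM : linSubst U M.det ≠ 0)
    {c : Matrix (Fin ℓ) ι K} {b : ι → MvPolynomial (Fin ℓ) K}
    (hc : ∀ i k, linSubst U (contract (M i) (n k)) = C (c i k) * b k) {w : ι → K}
    (hw : c.mulVec w = 0) : w = 0 := by
  classical
  have hb : ∀ k, b k ≠ 0 := fun k hk => by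
    obtain ⟨i, hi⟩ := exists_linSubst_contract_ne_zero hM (hn.ne_zero k)
    exact hi (by rw [hc, hk, mul_zero])
  rw [AlgHom.map_det] at hM
  -- If `c w = 0`, the substituted matrix kills `∑ (w k / b k) n k`; multiplying by `∏ b k` clears
  -- denominators.
  set g : ι → MvPolynomial (Fin ℓ) K := fun k => C (w k) * ∏ k' ∈ Finset.univ.erase k, b k'
  have hz := Matrix.eq_zero_of_mulVec_eq_zero hM (v := fun j => ∑ k, g k * C (n k j)) <| by
    funext i
    have hi : C (∑ k, c i k * w k) = (0 : MvPolynomial (Fin ℓ) K) := by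
      rw [show ∑ k, c i k * w k = 0 from congrFun hw i, C_0]
    calc ∑ j, linSubst U (M i j) * ∑ k, g k * C (n k j)
        = ∑ k, g k * linSubst U (contract (M i) (n k)) := by
          simp_rw [linSubst_contract, contract_apply, Finset.mul_sum]
          rw [Finset.sum_comm]
          exact Finset.sum_congr rfl fun k _ => Finset.sum_congr rfl fun j _ => by ring
      _ = ∑ k, C (c i k * w k) * ∏ k', b k' := by
          refine Finset.sum_congr rfl fun k _ => ?_
          rw [hc, ← Finset.mul_prod_erase _ b (Finset.mem_univ k), C_mul]
          ring
      _ = 0 := by rw [← Finset.sum_mul, ← map_sum, hi, zero_mul]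
  funext k
  have hgk := eq_zero_of_sum_mul_C_eq_zero hn (fun j => congrFun hz j) k
  simpa [g, Finset.prod_eq_zero_iff, hb] using hgk

/-- Substituting such a `U` plays the role of restriction to the common zeros of the forms in `W`.
-/
theorem exists_linearMap_ker_eq (W : Submodule K (Fin ℓ → K)) :
    ∃ U : (Fin ℓ → K) →ₗ[K] (Fin ℓ → K), LinearMap.ker U = W := by
  obtain ⟨W', hW'⟩ := W.exists_isCompl
  exact ⟨W'.subtype ∘ₗ W'.projectionOnto W hW'.symm, by
    rw [LinearMap.ker_comp_of_ker_eq_bot _ W'.ker_subtype]; simp⟩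

/-- The multiple addition step: a block of independent hyperplanes can be added at once. -/
theorem IsAdapted.exists_union {B P : Set (Submodule K (Fin ℓ → K))} {d : ℕ}
    {M : Matrix (Fin ℓ) (Fin ℓ) (MvPolynomial (Fin ℓ) K)} (hM : IsAdapted B d M)
    (hB : IsArrangement B) (hP : IsArrangement P) (hdisj : Disjoint B P)
    (hrank : rank P = P.ncard) (hinf : ¬ ∃ L ∈ B, sInf P ≤ L)
    (hcard : ∀ H ∈ P, B.ncard = d + (restriction (B ∪ {H}) H).ncard) :
    ∃ M', IsAdapted (B ∪ P) (d + 1) M' := by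
  classical
  have := hP.1.fintype
  have hn := linearIndependent_normal hP hrank
  have hnot : ∀ H : P, (H : Submodule K (Fin ℓ → K)) ∉ B := fun H hH =>
    Set.disjoint_left.mp hdisj hH H.2
  choose v hv using fun H : P => exists_dotProduct_eq_one (hP.2 H H.2).normal_ne_zero
  choose b hb hdeg hdvd using fun H : P =>
    exists_dvd_linSubst_contract_normal hB (hP.2 H H.2) (hnot H) (hv H)
  -- The degree of `b H` is exactly `d`, so the cofactor is constant.
  have hval : ∀ (i : Fin ℓ) (H : P), ∃ c : K,
      linSubst (projAlong (v H) (normal H.1)) (contract (M i) (normal H.1)) = C c * b H := by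
    refine fun i H => exists_eq_C_mul_of_dvd (hb H) (hdvd H (M i) fun L hL => hM.dvd L hL i) ?_
    have h1 := hdeg H
    have h2 := hcard H H.2
    have h3 := (totalDegree_linSubst_le (projAlong (v H) (normal H.1))
      (contract (M i) (normal H.1))).trans (totalDegree_contract_le (hM.totalDegree_le i) _)
    omega
  choose c hc using hval
  -- Restriction to the intersection of `P`: all normals of `P` die, and (MP2) keeps those of `B`
  -- alive.
  obtain ⟨U, hU⟩ := exists_linearMap_ker_eq (Submodule.span K (normal '' P))
  have hUB : ∀ L ∈ B, U (normal L) ≠ 0 := fun L hL h0 =>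
    hinf ⟨L, hL, sInf_le_of_normal_mem_span hP.2 (hB.2 L hL) (hU ▸ LinearMap.mem_ker.mpr h0)⟩
  have hUP : ∀ H : P, U ∘ₗ projAlong (v H) (normal H.1) = U := fun H => by
    have : U (normal H.1) = 0 := by
      rw [← LinearMap.mem_ker, hU]
      exact Submodule.subset_span ⟨H, H.2, rfl⟩
    ext1 i
    ext1
    simp [projAlong_apply, this]
  have hinj : Function.Injective (Matrix.of c).mulVecLin := by
    rw [injective_iff_map_eq_zero]
    refine fun w hw => mulVec_injective_of_linSubst_contract hn (hM.det_ne_zero U hUB)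
      (c := Matrix.of c) (b := fun H => linSubst U (b H)) (fun i H => ?_) hw
    -- Restricting to `H` first changes nothing, so the relations on the separate hyperplanes become
    -- simultaneous.
    rw [← hUP H, ← linSubst_comp, hc, map_mul, hUP H]
    simp [linSubst]
  obtain ⟨e, he⟩ := LinearMap.exists_leftInverse_of_injective _ (LinearMap.ker_eq_bot.mpr hinj)
  set E : Matrix P (Fin ℓ) K := LinearMap.toMatrix' e
  have hE : E * Matrix.of c = 1 := by
    have := congrArg LinearMap.toMatrix' he
    rwa [LinearMap.toMatrix'_comp, ← Matrix.toLin'_apply', LinearMap.toMatrix'_toLin',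
      LinearMap.toMatrix'_id] at this
  set c' : Matrix (Fin ℓ) P (MvPolynomial (Fin ℓ) K) := (Matrix.of c).map C
  set E' : Matrix P (Fin ℓ) (MvPolynomial (Fin ℓ) K) := E.map C
  have hc' : ∀ i H, c' i H = C (c i H) := fun _ _ => rfl
  have hEC : ∀ H i, E' H i = C (E H i) := fun _ _ => rfl
  have hE' : E' * c' = 1 := by
    rw [← Matrix.map_mul, hE, Matrix.map_one _ C_0 C_1]
  set D : Matrix P P (MvPolynomial (Fin ℓ) K) := Matrix.diagonal fun H => linForm (normal H.1)
  -- `Q` acts as `D` on the columns of `c'` and as the identity on the kernel of `E'`. A basis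
  -- change over `K` is thus built in, and the rows need not be homogeneous.
  set Q : Matrix (Fin ℓ) (Fin ℓ) (MvPolynomial (Fin ℓ) K) := 1 + c' * ((D - 1) * E') with hQ
  have hdet : Q.det = ∏ H : P, linForm (normal H.1) := by
    rw [hQ, Matrix.det_one_add_mul_comm, Matrix.mul_assoc, hE', Matrix.mul_one,
      add_sub_cancel, Matrix.det_diagonal]
  refine ⟨Q * M, ?_, ?_, ?_⟩
  · have hD : D - 1 = Matrix.diagonal fun H : P => linForm (normal H.1) - 1 := by
      rw [← Matrix.diagonal_one, Matrix.diagonal_sub]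
    have hQdeg : ∀ i j, (Q i j).totalDegree ≤ 1 := fun i j => by
      rw [hQ, Matrix.add_apply, Matrix.mul_apply, hD]
      refine (totalDegree_add _ _).trans (max_le ?_ ?_)
      · rw [Matrix.one_apply]
        split_ifs <;> simp
      · refine totalDegree_finsetSum_le fun H _ => ?_
        rw [Matrix.diagonal_mul]
        refine (totalDegree_mul _ _).trans ?_
        rw [hc', totalDegree_C, zero_add]
        refine (totalDegree_mul _ _).trans ?_
        rw [hEC, totalDegree_C, add_zero]
        refine (totalDegree_sub _ _).trans (max_le ?_ (by simp))
        exact (isHomogeneous_linForm _).totalDegree_le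
    intro i j
    rw [Matrix.mul_apply]
    refine totalDegree_finsetSum_le fun k _ => (totalDegree_mul _ _).trans ?_
    have h1 := hQdeg i k
    have h2 := hM.totalDegree_le k j
    omega
  · have hmul : ∀ a i, contract ((Q * M) i) a = Q.mulVec (fun j => contract (M j) a) i := by
      intro a i
      rw [← mulVec_eq_contract, ← Matrix.mulVec_mulVec]
      congr 2
      funext j
      exact mulVec_eq_contract M a j
    rintro L (hL | hL) i
    · rw [hmul, Matrix.mulVec, dotProduct]
      exact Finset.dvd_sum fun j _ => (hM.dvd L hL j).mul_left _
    · rw [hmul, linForm_dvd_iff (hv ⟨L, hL⟩)]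
      set H : P := ⟨L, hL⟩
      set ρ := linSubst (projAlong (v H) (normal L))
      have hρC : ∀ r : K, ρ (C r) = C r := fun r => by simp [ρ, linSubst]
      have hρc : c'.map ρ = c' := by ext1 i k; exact hρC _
      have hρE : E'.map ρ = E' := by ext1 i k; exact hρC _
      have hρu : (fun j => ρ (contract (M j) (normal L))) =
          c'.mulVec (Pi.single H (b H)) := by
        funext j
        rw [Matrix.mulVec_single]
        simpa [hc', mul_comm] using hc j H
      have hρ0 : ρ (linForm (normal L)) = 0 := by
        rw [linSubst_linForm, projAlong_self (hv H), map_zero]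
      -- The entry of `D` at `H` vanishes on `H`, so there `Q` kills the column of `c'` at `H`,
      -- which carries the values of the rows on the normal of `H`.
      have hDρ : ((D - 1).map ρ).mulVec (Pi.single H (b H)) = - Pi.single H (b H) := by
        rw [Matrix.map_sub _ (map_sub ρ), Matrix.map_one _ (map_zero ρ) (map_one ρ),
          Matrix.sub_mulVec, Matrix.one_mulVec, Matrix.diagonal_map (map_zero ρ)]
        simp [H, hρ0]
      have hQρ : Q.map ρ = 1 + c' * ((D - 1).map ρ * E') := by
        rw [hQ, Matrix.map_add _ (map_add ρ), Matrix.map_one _ (map_zero ρ) (map_one ρ),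
          Matrix.map_mul, Matrix.map_mul, hρc, hρE]
      calc ρ (Q.mulVec (fun j => contract (M j) (normal L)) i)
          = ((Q.map ρ).mulVec (fun j => ρ (contract (M j) (normal L)))) i := by
            simp [Matrix.mulVec, dotProduct]
        _ = 0 := by
          rw [hρu, hQρ, Matrix.add_mulVec, Matrix.one_mulVec, ← Matrix.mulVec_mulVec,
            ← Matrix.mulVec_mulVec, Matrix.mulVec_mulVec _ E', hE', Matrix.one_mulVec, hDρ,
            Matrix.mulVec_neg, add_neg_cancel, Pi.zero_apply]
  · intro V hV
    rw [Matrix.det_mul, map_mul, hdet, map_prod]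
    refine mul_ne_zero (Finset.prod_ne_zero_iff.mpr fun H _ => ?_)
      (hM.det_ne_zero V fun L hL => hV L (Or.inl hL))
    rw [linSubst_linForm]
    exact linForm_ne_zero (hV H (Or.inr H.2))

/-! ### Decompositions and empty blocks -/

theorem IsArrangement.mono {A B : Set (Submodule K (Fin ℓ → K))} (hA : IsArrangement A)
    (h : B ⊆ A) : IsArrangement B :=
  ⟨hA.1.subset h, fun H hH => hA.2 H (h hH)⟩

/-- The union of the first `t` blocks. -/
def firstBlocks {n : ℕ} (π : Fin n → Set (Submodule K (Fin ℓ → K))) (t : ℕ) :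
    Set (Submodule K (Fin ℓ → K)) :=
  ⋃ j : Fin n, ⋃ _ : (j : ℕ) < t, π j

theorem mem_firstBlocks {n : ℕ} {π : Fin n → Set (Submodule K (Fin ℓ → K))} {t : ℕ}
    {H : Submodule K (Fin ℓ → K)} : H ∈ firstBlocks π t ↔ ∃ j : Fin n, (j : ℕ) < t ∧ H ∈ π j := by
  simp [firstBlocks]

theorem before_eq_firstBlocks {n : ℕ} (π : Fin n → Set (Submodule K (Fin ℓ → K))) (k : Fin n) :
    before π k = firstBlocks π k := rfl

theorem firstBlocks_succ {n : ℕ} (π : Fin n → Set (Submodule K (Fin ℓ → K))) (k : Fin n) :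
    firstBlocks π (k + 1) = firstBlocks π k ∪ π k := by
  ext H
  simp only [Set.mem_union, mem_firstBlocks, Nat.lt_succ_iff_lt_or_eq, ← Fin.ext_iff, or_and_right,
    exists_or, exists_eq_left]

namespace IsMATDecomposition

variable {A : Set (Submodule K (Fin ℓ → K))} {n : ℕ} {π : Fin n → Set (Submodule K (Fin ℓ → K))}

theorem block_subset (h : IsMATDecomposition A π) (k : Fin n) : π k ⊆ A :=
  h.iUnion_eq ▸ Set.subset_iUnion π k

theorem firstBlocks_subset (h : IsMATDecomposition A π) (t : ℕ) : firstBlocks π t ⊆ A :=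
  Set.iUnion_subset fun j => Set.iUnion_subset fun _ => h.block_subset j

theorem disjoint_firstBlocks (h : IsMATDecomposition A π) (k : Fin n) :
    Disjoint (firstBlocks π k) (π k) := by
  refine Set.disjoint_left.mpr fun H hH hk => ?_
  obtain ⟨j, hj, hHj⟩ := mem_firstBlocks.mp hH
  exact Set.disjoint_left.mp (h.disjoint j k (Fin.ne_of_lt hj)) hHj hk

theorem ncard_eq (h : IsMATDecomposition A π) {k : Fin n} {H : Submodule K (Fin ℓ → K)}
    (hH : H ∈ π k) : (firstBlocks π k).ncard =
      k + (restriction (firstBlocks π k ∪ {H}) H).ncard := by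
  have := h.mp3 k H hH
  rw [before_eq_firstBlocks] at this
  omega

theorem exists_isAdapted (h : IsMATDecomposition A π) (hA : IsArrangement A) (t : ℕ)
    (ht : t ≤ n) : ∃ M, IsAdapted (firstBlocks π t) t M := by
  induction t with
  | zero =>
    have : firstBlocks π 0 = ∅ := by simp [firstBlocks]
    exact ⟨1, this ▸ isAdapted_empty⟩
  | succ t ih =>
    obtain ⟨M, hM⟩ := ih (Nat.le_of_succ_le ht)
    rw [firstBlocks_succ π ⟨t, ht⟩]
    exact hM.exists_union (hA.mono (h.firstBlocks_subset _)) (hA.mono (h.block_subset _))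
      (h.disjoint_firstBlocks ⟨t, ht⟩) (h.mp1 _) (h.mp2 ⟨t, ht⟩)
      fun H hH => h.ncard_eq (k := ⟨t, ht⟩) hH

/-- All blocks after an empty block are empty. -/
theorem eq_empty_of_le (h : IsMATDecomposition A π) (hA : IsArrangement A) {p : Fin n}
    (hp : π p = ∅) (k : Fin n) (hk : p ≤ k) : π k = ∅ := by
  induction k using WellFoundedLT.induction with
  | ind k ih =>
    refine Set.eq_empty_iff_forall_notMem.mpr fun H hH => ?_
    -- By induction the blocks from `p` up to `k` contribute nothing.
    have hblocks : firstBlocks π k = firstBlocks π p := by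
      ext L
      rw [mem_firstBlocks, mem_firstBlocks]
      constructor
      · rintro ⟨j, hj, hL⟩
        refine ⟨j, not_le.mp fun hpj => ?_, hL⟩
        rw [ih j hj hpj] at hL
        exact hL
      · rintro ⟨j, hj, hL⟩
        exact ⟨j, lt_of_lt_of_le hj hk, hL⟩
    have hnot : H ∉ firstBlocks π k := fun hH' =>
      Set.disjoint_left.mp (h.disjoint_firstBlocks k) hH' hH
    have heq := h.ncard_eq hH
    rw [hblocks] at heq hnot
    obtain ⟨M, hM⟩ := h.exists_isAdapted hA p p.2.le
    have hle := hM.ncard_le (hA.mono (h.firstBlocks_subset _))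
      (hA.2 H (h.block_subset k hH)) hnot
    -- `heq` gives drop `k`, `hle` gives drop at most `p`.
    have hkp : k = p := le_antisymm (Fin.le_def.mpr (by omega)) hk
    rw [hkp, hp] at hH
    exact hH

theorem isMATPartition_castLE (h : IsMATDecomposition A π) (hne : A.Nonempty) {p : ℕ} (hp : p ≤ n)
    (hπ : ∀ k : Fin n, (π k).Nonempty ↔ (k : ℕ) < p) :
    IsMATPartition A fun k : Fin p => π (Fin.castLE hp k) := by
  have hbefore : ∀ k : Fin p, before (fun k : Fin p => π (Fin.castLE hp k)) k =
      before π (Fin.castLE hp k) := fun k => by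
    ext H
    simp only [before, Set.mem_iUnion, exists_prop]
    constructor
    · rintro ⟨j, hj, hH⟩
      exact ⟨Fin.castLE hp j, hj, hH⟩
    · rintro ⟨j, hj, hH⟩
      exact ⟨⟨j, (hπ j).mp ⟨H, hH⟩⟩, hj, hH⟩
  refine ⟨⟨?_, ?_, fun k => h.mp1 _, fun k => ?_, fun k => ?_⟩, hne, fun k => (hπ _).mpr k.2⟩
  · rw [← h.iUnion_eq]
    ext H
    simp only [Set.mem_iUnion]
    constructor
    · rintro ⟨j, hH⟩
      exact ⟨_, hH⟩
    · rintro ⟨j, hH⟩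
      exact ⟨⟨j, (hπ j).mp ⟨H, hH⟩⟩, hH⟩
  · exact fun i j hij => h.disjoint _ _ ((Fin.castLE_injective hp).ne hij)
  · rw [MP2, hbefore]
    exact h.mp2 _
  · rw [MP3, hbefore]
    exact h.mp3 _

theorem exists_nonempty_iff_lt (h : IsMATDecomposition A π) (hA : IsArrangement A) :
    ∃ p ≤ n, ∀ k : Fin n, (π k).Nonempty ↔ (k : ℕ) < p := by
  classical
  -- The condition holds vacuously at `n`, which covers the case without empty blocks.
  have hex : ∃ p : ℕ, ∀ hp : p < n, π ⟨p, hp⟩ = ∅ := ⟨n, fun hn => absurd hn (lt_irrefl n)⟩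
  refine ⟨Nat.find hex, Nat.find_min' hex fun hn => absurd hn (lt_irrefl n), fun k => ?_⟩
  constructor
  · refine fun hk => not_le.mp fun hle => hk.ne_empty ?_
    exact h.eq_empty_of_le hA (Nat.find_spec hex (hle.trans_lt k.2)) k hle
  · intro hk
    have := Nat.find_min hex hk
    push Not at this
    exact this.2

end IsMATDecomposition

/-- At least one block is required, so the empty arrangement is given a single empty one. -/
theorem isMATDecomposition_empty :
    IsMATDecomposition (∅ : Set (Submodule K (Fin ℓ → K))) fun _ : Fin 1 => ∅ where
  iUnion_eq := by simp
  disjoint _ _ _ := Set.disjoint_empty _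
  mp1 _ := by
    rw [MP1, Set.ncard_empty, rank, sInf_empty]
    exact Module.finrank_zero_of_subsingleton
  mp2 _ := by simp [MP2, before]
  mp3 _ H hH := absurd hH (Set.notMem_empty H)

end Arrangement

theorem proposition4p1 {K : Type*} [Field K] {ℓ : ℕ} (hℓ : 0 < ℓ)
    (A : Set (Submodule K (Fin ℓ → K))) (hA : Arrangement.IsArrangement A) :
    (Arrangement.IsMATFree A ↔
      ∃ (n : ℕ) (_ : 0 < n) (π : Fin n → Set (Submodule K (Fin ℓ → K))),
        Arrangement.IsMATDecomposition A π) ∧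
    (∀ (n : ℕ) (π : Fin n → Set (Submodule K (Fin ℓ → K))),
      Arrangement.IsMATDecomposition A π →
        ∃ (p : ℕ) (hp : p ≤ n),
          (∀ k : Fin n, (π k).Nonempty ↔ (k : ℕ) < p) ∧
          (A.Nonempty →
            Arrangement.IsMATPartition A (fun k : Fin p => π (Fin.castLE hp k)))) := by
  have hpart : ∀ (n : ℕ) (π : Fin n → Set (Submodule K (Fin ℓ → K))),
      Arrangement.IsMATDecomposition A π →
        ∃ (p : ℕ) (hp : p ≤ n),
          (∀ k : Fin n, (π k).Nonempty ↔ (k : ℕ) < p) ∧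
          (A.Nonempty →
            Arrangement.IsMATPartition A (fun k : Fin p => π (Fin.castLE hp k))) := by
    intro n π h
    obtain ⟨p, hp, hπ⟩ := h.exists_nonempty_iff_lt hA
    exact ⟨p, hp, hπ, fun hne => h.isMATPartition_castLE hne hp hπ⟩
  refine ⟨⟨?_, ?_⟩, hpart⟩
  · rintro (rfl | ⟨n, π, h⟩)
    · exact ⟨1, one_pos, _, Arrangement.isMATDecomposition_empty⟩
    · obtain ⟨H, hH⟩ := h.nonempty
      rw [← h.iUnion_eq] at hH
      obtain ⟨k, -⟩ := Set.mem_iUnion.mp hH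
      exact ⟨n, k.pos, π, h.toIsMATDecomposition⟩
  · rintro ⟨n, -, π, h⟩
    rcases A.eq_empty_or_nonempty with hempty | hne
    · exact Or.inl hempty
    · obtain ⟨p, hp, -, hmat⟩ := hpart n π h
      exact Or.inr ⟨p, _, hmat hne⟩
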